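/- Let $R_{\max}\ge 0$, and let $\mathcal M$ be a (not necessarily time-homogeneous) discounted Markov decision process with state space $\mathcal S$, action space $\mathcal A$, initial state law $\nu$, transition kernels $\mathbb P_h(\cdot\mid s,a)$, possibly random rewards with laws $\mathcal R_h(\cdot\mid s,a)$ on $[0,R_{\max}]$, and discount factor $\gamma\in(0,1)$. Let $(\pi_\theta)_{\theta\in\Theta}$ be a family of stochastic Markov policies and let $H\in\{0,1,2,\dots\}\cup\{\infty\}$ be the horizon. Each $\pi_\theta$ induces a Markov chain $\xi=(X_h)_{1\le h\le H}$ (with $h<\infty$), $X_h=(S_h,A_h,R_h)\in\Lambda=\mathcal S\times\mathcal A\times[0,R_{\max}]$, where $S_1\sim\nu$, $A_h\sim\pi_{\theta,h}(\cdot\mid S_h)$, $R_h\sim\mathcal R_h(\cdot\mid S_h,A_h)$, $S_{h+1}\sim\mathbb P_h(\cdot\mid S_h,A_h)$; write $\mathcal M_\theta$ for its law. For $0\le\varepsilon<1$ let $\tau_\theta(\varepsilon)$ be the least integer $t\ge 0$ such that $$d_{TV}\bigl(\mathrm{Law}(X_{i+t}\mid X_i=x),\mathrm{Law}(X_{i+t}\mid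 X_i=y)\bigr)\le\varepsilon\quad\text{for all } i\ge 1 \text{ with } i+t\le H \text{ and all } x,y\in\Lambda$$ ($\tau_\theta(\varepsilon)=\infty$ if there is none), and let $$\tau_{\min}(\theta)=\inf_{0\le\varepsilon<1}\tau_\theta(\varepsilon)\Bigl(\frac{2-\varepsilon}{1-\varepsilon}\Bigr)^2,\qquad \tau_{\min}=\sup_{\theta\in\Theta}\tau_{\min}(\theta).$$ Assume $\tau_{\min}<\infty$. For a trajectory $\xi$ let $G(\xi)=\sum_{h=1}^{H}\gamma^{h-1}R_h$, and let $V_{\pi_\theta}=\mathbb E_{\xi\sim\mathcal M_\theta}[G(\xi)]$ and $\mathcal L(\theta)=-V_{\pi_\theta}$. Let $T\ge 1$. On some probability space let, for every $\theta$, $\mathfrak D_\theta=(\xi^{(1)}_\theta,\dots,\xi^{(T)}_\theta)$ consist of $T$ independent trajectories with law $\mathcal M_\theta$, the samples for different $\theta$ being arbitrarily dependent but jointly measurable in $\theta$ and the random outcome; put $\hat{\mathcal L}_{\mathfrak D}(\theta)=-\frac1T\sum_{j=1}^{T}G(\xi^{(j)}_\theta)$. Then for every prior probability measure $\mu$ on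 $\Theta$ (fixed independently of the data) and every $\delta\in(0,1)$, with probability at least $1-\delta$, simultaneously for all posterior probability measures $\rho$ on $\Theta$ (which may thus depend on the data), $$\mathbb E_{\theta\sim\rho}\bigl[\mathcal L(\theta)-\hat{\mathcal L}_{\mathfrak D}(\theta)\bigr]\le\sqrt{\frac{R_{\max}^2\,\tau_{\min}\,(1-\gamma^{2H})}{2T(1-\gamma^2)}\Bigl(\mathrm{KL}(\rho\Vert\mu)+\ln\frac2\delta\Bigr)},$$ and hence $$\mathbb E_{\theta\sim\rho}[V_{\pi_\theta}]\ge\mathbb E_{\theta\sim\rho}\bigl[-\hat{\mathcal L}_{\mathfrak D}(\theta)\bigr]-\sqrt{\frac{R_{\max}^2\,\tau_{\min}\,(1-\gamma^{2H})}{2T(1-\gamma^2)}\Bigl(\mathrm{KL}(\rho\Vert\mu)+\ln\frac2\delta\Bigr)}.$$ All expectations over $\rho$ exist when $\mathrm{KL}(\rho\Vert\mu)<\infty$; for $\mathrm{KL}(\rho\Vert\mu)=\infty$ the bounds are read as trivial. For $H=\infty$, $\gamma^{2H}=0$. -/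

import Mathlib

open MeasureTheory ProbabilityTheory
open scoped ENNReal

namespace PacBayesRL

noncomputable section

/-- A discounted Markov decision process, not necessarily time-homogeneous, with state space `S`,
action space `A`, initial state law, transition kernels, (possibly random) rewards with values in
`[0, Rmax]`, and discount factor `γ ∈ (0, 1)`. Time is counted from `0`. -/
structure MDP (S A : Type*) [MeasurableSpace S] [MeasurableSpace A] (Rmax : ℝ) where
  /-- law of the initial state -/
  init : Measure S
  /-- law of the state at time `h + 1` given state and action at time `h` -/
  trans : ℕ → Kernel (S × A) S
  /-- law of the reward at time `h` given state and action at time `h` -/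
  reward : ℕ → Kernel (S × A) (Set.Icc (0 : ℝ) Rmax)
  /-- discount factor -/
  γ : ℝ
  init_prob : IsProbabilityMeasure init
  trans_markov : ∀ h, IsMarkovKernel (trans h)
  reward_markov : ∀ h, IsMarkovKernel (reward h)
  γ_pos : 0 < γ
  γ_lt_one : γ < 1

attribute [instance] MDP.init_prob MDP.trans_markov MDP.reward_markov

/-- A (Markov, stochastic, possibly time-dependent) policy. -/
structure Policy (S A : Type*) [MeasurableSpace S] [MeasurableSpace A] where
  /-- law of the action at time `h` given the state at time `h` -/
  act : ℕ → Kernel S A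
  act_markov : ∀ h, IsMarkovKernel (act h)

attribute [instance] Policy.act_markov

/-- The values of one element `(S_h, A_h, R_h)` of a trajectory. -/
abbrev Step (S A : Type*) (Rmax : ℝ) : Type _ := S × A × Set.Icc (0 : ℝ) Rmax

/-- The time indices `h < H`; the horizon `H` may be infinite. -/
abbrev Times (H : ℕ∞) : Type := {h : ℕ // (h : ℕ∞) < H}

/-- Trajectories `(S_h, A_h, R_h)`, `h < H`. -/
abbrev Traj (S A : Type*) (Rmax : ℝ) (H : ℕ∞) : Type _ := Times H → Step S A Rmax

/-- Total variation distance of two (probability) measures. -/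
def tvDist {X : Type*} [MeasurableSpace X] (μ ν : Measure X) : ℝ≥0∞ :=
  ⨆ (B : Set X) (_ : MeasurableSet B), ENNReal.ofReal |μ.real B - ν.real B|

section Chain

variable {S A : Type*} [MeasurableSpace S] [MeasurableSpace A] {Rmax : ℝ}

/-- The law of `(S_h, A_h, R_h)` given `S_h`. -/
def tupleKernel (M : MDP S A Rmax) (p : Policy S A) (h : ℕ) : Kernel S (Step S A Rmax) :=
  Kernel.id ×ₖ (p.act h ⊗ₖ M.reward h)

instance (M : MDP S A Rmax) (p : Policy S A) (h : ℕ) : IsMarkovKernel (tupleKernel M p h) := by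
  unfold tupleKernel; infer_instance

/-- The state-action pair of a step. -/
def stateAction (x : Step S A Rmax) : S × A := (x.1, x.2.1)

lemma measurable_stateAction : Measurable (stateAction : Step S A Rmax → S × A) := by
  unfold stateAction; fun_prop

/-- One-step kernel of the policy-induced chain: the law of `(S_{h+1}, A_{h+1}, R_{h+1})`
given `(S_h, A_h, R_h)`. -/
def stepKernel (M : MDP S A Rmax) (p : Policy S A) (h : ℕ) :
    Kernel (Step S A Rmax) (Step S A Rmax) :=
  tupleKernel M p (h + 1) ∘ₖ (M.trans h).comap stateAction measurable_stateAction

instance (M : MDP S A Rmax) (p : Policy S A) (h : ℕ) : IsMarkovKernel (stepKernel M p h) := by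
  unfold stepKernel; infer_instance

/-- The law of `(S_0, A_0, R_0)`. -/
def initStep (M : MDP S A Rmax) (p : Policy S A) : Measure (Step S A Rmax) :=
  tupleKernel M p 0 ∘ₘ M.init

/-- Law of the infinite Markov chain induced by the policy. -/
def chainLaw (M : MDP S A Rmax) (p : Policy S A) : Measure (ℕ → Step S A Rmax) :=
  Kernel.trajMeasure (X := fun _ => Step S A Rmax) (initStep M p)
    (fun n => (stepKernel M p n).comap (fun x => x ⟨n, Finset.mem_Iic.2 le_rfl⟩)
      (measurable_pi_apply _))

/-- Law of a trajectory with horizon `H` under the policy. -/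
def trajLaw (M : MDP S A Rmax) (p : Policy S A) (H : ℕ∞) : Measure (Traj S A Rmax H) :=
  (chainLaw M p).map (fun ξ i => ξ i.1)

/-- The `t`-step kernel: law of the chain at time `i + t` given its value at time `i`. -/
def lagKernel (M : MDP S A Rmax) (p : Policy S A) (i : ℕ) :
    ℕ → Kernel (Step S A Rmax) (Step S A Rmax)
  | 0 => Kernel.id
  | t + 1 => stepKernel M p (i + t) ∘ₖ lagKernel M p i t

/-- The mixing time `τ(ε)` of the chain with horizon `H`: the least `t` such that for all times
`i` with `i + t < H` and all `x`, `y`, the laws of the chain at time `i + t` given the values `x`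
or `y` at time `i` are `ε`-close in total variation; `∞` if there is no such `t`. -/
def mixingTime (M : MDP S A Rmax) (p : Policy S A) (H : ℕ∞) (ε : ℝ) : ℝ≥0∞ :=
  ⨅ (t : ℕ) (_ : ∀ i : ℕ, ((i + t : ℕ) : ℕ∞) < H → ∀ x y : Step S A Rmax,
    tvDist (lagKernel M p i t x) (lagKernel M p i t y) ≤ ENNReal.ofReal ε), (t : ℝ≥0∞)

/-- The normalized mixing time `inf_{0 ≤ ε < 1} τ(ε) ((2 - ε) / (1 - ε))²`. -/
def tauMin (M : MDP S A Rmax) (p : Policy S A) (H : ℕ∞) : ℝ≥0∞ :=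
  ⨅ ε ∈ Set.Ico (0 : ℝ) 1,
    mixingTime M p H ε * ENNReal.ofReal (((2 - ε) / (1 - ε)) ^ 2)

/-- Discounted return `∑_{h < H} γ ^ h R_h` of a trajectory. -/
def ret {H : ℕ∞} (γ : ℝ) (ξ : Traj S A Rmax H) : ℝ :=
  ∑' h : Times H, γ ^ h.1 * ((ξ h).2.2 : ℝ)

/-- Value of a policy: expected discounted return. -/
def value (M : MDP S A Rmax) (p : Policy S A) (H : ℕ∞) : ℝ :=
  ∫ ξ, ret M.γ ξ ∂(trajLaw M p H)

/-- The true loss. -/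
def trueLoss (M : MDP S A Rmax) (p : Policy S A) (H : ℕ∞) : ℝ :=
  - value M p H

/-- The empirical loss of a sample of `T` trajectories. -/
def empLoss {H : ℕ∞} {T : ℕ} (γ : ℝ) (D : Fin T → Traj S A Rmax H) : ℝ :=
  - ((1 / (T : ℝ)) * ∑ j, ret γ (D j))

/-- Law of a sample of `T` independent trajectories under the policy. -/
def sampleLaw (M : MDP S A Rmax) (p : Policy S A) (H : ℕ∞) (T : ℕ) :
    Measure (Fin T → Traj S A Rmax H) :=
  Measure.pi fun _ => trajLaw M p H

end Chain

/-- `γ ^ (2 H)`, which is `0` for `H = ∞`. -/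
def powTwoHorizon (γ : ℝ) (H : ℕ∞) : ℝ := if H = ⊤ then 0 else γ ^ (2 * H.toNat)

end

end PacBayesRL

/-!
The proof rests on a concentration inequality for the discounted return and on the usual
change-of-measure argument.

*Concentration.* Suppose that the chain of a policy forgets its state within `t` steps up to `ε`.
Then the kernels over `2t` steps contract oscillations by `ε²`. The return is an additive
functional, so it splits into `2t` sums over the residue classes of times modulo `2t`. Each of
these is an additive functional of a Markov chain whose kernels contract by `q = ε²`, and the
martingale method with Hoeffding's lemma (`IsMarkovChain.hasSubgaussianMGF_sum`) shows that it is
sub-Gaussian with constant `∑ aₗ² / (4 (1 - q)²)`, where `aₗ` are the ranges of its summands. Adding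
the classes by Hölder's inequality (`HasSubgaussianMGF.sum`) costs a factor `2t`. As
`(1 + ε) (2 - ε) ≥ 2`, the return is sub-Gaussian with constant
`K = τ Rmax² (1 - γ^{2H}) / (8 (1 - γ²))` (`PacBayesRL.hasSubgaussianMGF_ret`). This is half of the
constant that a McDiarmid inequality for general functions of the chain would give, and the gain
is what makes the next step work without a logarithmic loss.

*Change of measure.* The difference `Δ θ` of true and empirical loss is sub-Gaussian with constant
`c = K / T`. Hence `E exp (Δ² / (4c)) ≤ √2 ≤ 2`
(`ProbabilityTheory.HasSubgaussianMGF.lintegral_exp_sq_le`), and by Markov's inequality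
`∫ exp (Δ² / (4c)) dμ ≤ 2 / δ` with probability at least `1 - δ`. On this event the
Donsker–Varadhan inequality and Jensen's inequality give
`(∫ Δ dρ)² ≤ 4c (KL(ρ ‖ μ) + log (2 / δ))` for all `ρ` at once
(`exists_forall_integral_le_sqrt_klDiv`); and `4c` is the constant in the claim.
-/

/-! ### Sub-Gaussian variables and PAC-Bayes bounds -/

section
open Real
open scoped NNReal

lemma ProbabilityTheory.exp_mul_sq_eq_integral_gaussianReal (v : ℝ≥0) (x : ℝ) :
    ENNReal.ofReal (exp (v * x ^ 2 / 2)) =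
      ∫⁻ z, ENNReal.ofReal (exp (x * z)) ∂(gaussianReal 0 v) := by
  have h : mgf id (gaussianReal 0 v) x = exp (v * x ^ 2 / 2) := by
    rw [mgf_id_gaussianReal]; simp
  rw [← h, mgf]
  exact ofReal_integral_eq_lintegral_ofReal (integrable_exp_mul_gaussianReal x)
    (ae_of_all _ fun _ => (exp_pos _).le)

/-- Writing `exp (x² / (4c))` as a Gaussian average of `exp (x z)` reduces the claim to the bound
`exp (c z² / 2)` on the moment generating function; the resulting Gaussian integral is `√2`. -/
lemma ProbabilityTheory.HasSubgaussianMGF.lintegral_exp_sq_le {Ω : Type*} [MeasurableSpace Ω]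
    {P : Measure Ω} [IsProbabilityMeasure P] {X : Ω → ℝ} {c : ℝ≥0} (hX : Measurable X)
    (h : HasSubgaussianMGF X c P) (hc : c ≠ 0) :
    ∫⁻ ω, ENNReal.ofReal (exp (X ω ^ 2 / (4 * c))) ∂P ≤ 2 := by
  have hc' : (0 : ℝ) < c := by positivity
  set v : ℝ≥0 := (2 * c)⁻¹ with hv
  have hv0 : v ≠ 0 := by simp [hv, hc]
  have hvR : (v : ℝ) = (2 * (c : ℝ))⁻¹ := by simp [hv]
  calc ∫⁻ ω, ENNReal.ofReal (exp (X ω ^ 2 / (4 * c))) ∂P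
      = ∫⁻ ω, ∫⁻ z, ENNReal.ofReal (exp (X ω * z)) ∂(gaussianReal 0 v) ∂P := by
        refine lintegral_congr fun ω => ?_
        rw [← exp_mul_sq_eq_integral_gaussianReal, hvR]
        congr 2; field_simp; ring
    _ = ∫⁻ z, ∫⁻ ω, ENNReal.ofReal (exp (X ω * z)) ∂P ∂(gaussianReal 0 v) := by
        refine lintegral_lintegral_swap ?_
        exact Measurable.aemeasurable (by fun_prop)
    _ ≤ ∫⁻ z, ENNReal.ofReal (exp (c * z ^ 2 / 2)) ∂(gaussianReal 0 v) := by
        refine lintegral_mono fun z => ?_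
        have := h.mgf_le z
        rw [mgf] at this
        simp_rw [mul_comm z] at this
        have hi := h.integrable_exp_mul z
        simp_rw [mul_comm z] at hi
        rw [← ofReal_integral_eq_lintegral_ofReal hi (ae_of_all _ fun _ => (exp_pos _).le)]
        exact ENNReal.ofReal_le_ofReal this
    _ = ∫⁻ z, ENNReal.ofReal (√(c / π) * exp (-(c / 2) * z ^ 2)) := by
        rw [gaussianReal_of_var_ne_zero 0 hv0, lintegral_withDensity_eq_lintegral_mul _
          (by fun_prop) (by fun_prop)]
        refine lintegral_congr fun z => ?_
        simp only [Pi.mul_apply, gaussianPDF, gaussianPDFReal]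
        rw [← ENNReal.ofReal_mul (by positivity), mul_assoc, ← exp_add]
        congr 2
        · rw [← sqrt_inv, hvR]; congr 1; field_simp
        · rw [hvR]; congr 1; field_simp; ring
    _ = ENNReal.ofReal (√(c / π) * √(π / (c / 2))) := by
        rw [← ofReal_integral_eq_lintegral_ofReal
          ((integrable_exp_neg_mul_sq (by positivity)).const_mul _)
          (ae_of_all _ fun _ => by positivity), integral_const_mul, integral_gaussian]
    _ ≤ 2 := by
        rw [← sqrt_mul (by positivity)]
        have : (c : ℝ) / π * (π / (c / 2)) = 2 := by
          have := pi_pos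
          field_simp
        rw [this, show (2 : ℝ≥0∞) = ENNReal.ofReal 2 by simp]
        refine ENNReal.ofReal_le_ofReal ?_
        rw [sqrt_le_left (by norm_num)]; norm_num

/-- The easy half of the Donsker–Varadhan formula: the divergence of `ρ` from the tilted measure
`μ.tilted f` is nonnegative. -/
lemma MeasureTheory.integral_le_klDiv_add_log {Θ : Type*} [MeasurableSpace Θ] {ρ μ : Measure Θ}
    [IsProbabilityMeasure ρ] [IsProbabilityMeasure μ] {f : Θ → ℝ}
    (hkl : InformationTheory.klDiv ρ μ ≠ ∞) (hfρ : Integrable f ρ)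
    (hfμ : Integrable (fun θ => exp (f θ)) μ) :
    ∫ θ, f θ ∂ρ ≤ (InformationTheory.klDiv ρ μ).toReal + log (∫ θ, exp (f θ) ∂μ) := by
  obtain ⟨hac, hllr⟩ := InformationTheory.klDiv_ne_top_iff.1 hkl
  have := isProbabilityMeasure_tilted hfμ
  have h := integral_llr_tilted_right hac hfρ hfμ hllr
  have hac' : ρ ≪ μ.tilted f := hac.trans (absolutelyContinuous_tilted hfμ)
  have h2 : 0 ≤ ∫ x, llr ρ (μ.tilted f) x ∂ρ := by
    rw [← InformationTheory.toReal_klDiv_of_measure_eq hac' (by simp)]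
    positivity
  rw [InformationTheory.toReal_klDiv_of_measure_eq hac (by simp)]
  linarith

/-- PAC-Bayes bound for a uniformly bounded family of variables that are sub-Gaussian with a common
constant `c`. The variables of different parameters may be dependent. -/
lemma exists_forall_integral_le_sqrt_klDiv {Θ Ω : Type*} [MeasurableSpace Θ] [MeasurableSpace Ω]
    {P : Measure Ω} [IsProbabilityMeasure P] {X : Θ → Ω → ℝ}
    (hX : Measurable fun q : Θ × Ω => X q.1 q.2) {B : ℝ} (hB : ∀ θ ω, |X θ ω| ≤ B) {c : ℝ≥0}
    (hsub : ∀ θ, HasSubgaussianMGF (X θ) c P) (μ : Measure Θ) [IsProbabilityMeasure μ]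
    {δ : ℝ} (hδ0 : 0 < δ) :
    ∃ E : Set Ω, MeasurableSet E ∧ ENNReal.ofReal (1 - δ) ≤ P E ∧
      ∀ ω ∈ E, ∀ ρ : Measure Θ, IsProbabilityMeasure ρ → InformationTheory.klDiv ρ μ ≠ ∞ →
        ∫ θ, X θ ω ∂ρ ≤ √(4 * c * ((InformationTheory.klDiv ρ μ).toReal + log (2 / δ))) := by
  have hXω : ∀ ω, Measurable fun θ => X θ ω := fun ω => hX.comp measurable_prodMk_right
  have hXθ : ∀ θ, Measurable (X θ) := fun θ => hX.comp measurable_prodMk_left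
  have hX' : Measurable (Function.uncurry X) := hX
  -- For `c = 0` every `X θ` vanishes almost surely, and Fubini's theorem gives one null set
  -- outside of which `X θ ω = 0` for `μ`-almost all, hence for `ρ`-almost all `θ`.
  rcases eq_or_ne c 0 with rfl | hc
  · have hae : ∀ᵐ ω ∂P, ∀ᵐ θ ∂μ, X θ ω = 0 := by
      have h1 : ∀ᵐ q ∂(μ.prod P), X q.1 q.2 = 0 := by
        rw [Measure.ae_prod_iff_ae_ae (measurableSet_eq_fun hX measurable_const)]
        exact ae_of_all _ fun θ => (hsub θ).ae_eq_zero_of_hasSubgaussianMGF_zero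
      have h2 := (Measure.ae_prod_iff_ae_ae (μ := P) (ν := μ)
        (p := fun q : Ω × Θ => X q.2 q.1 = 0)
        (measurableSet_eq_fun (hX.comp measurable_swap) measurable_const)).1
      refine h2 ?_
      rw [← Measure.prod_swap] at h1
      exact ae_of_ae_map measurable_swap.aemeasurable h1
    obtain ⟨N, hN, hNm, hN0⟩ := exists_measurable_superset_of_null (ae_iff.1 hae)
    refine ⟨Nᶜ, hNm.compl, ?_, fun ω hω ρ hρ hkl => ?_⟩
    · rw [prob_compl_eq_one_sub hNm, hN0, tsub_zero, ← ENNReal.ofReal_one]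
      exact ENNReal.ofReal_le_ofReal (by linarith)
    · have hω' : ∀ᵐ θ ∂μ, X θ ω = 0 := by
        by_contra hcon
        exact hω (hN hcon)
      have := (InformationTheory.klDiv_ne_top_iff.1 hkl).1.ae_le hω'
      rw [integral_congr_ae this]
      simp
  have hc' : (0 : ℝ) < c := by positivity
  set F : Ω → ℝ≥0∞ := fun ω => ∫⁻ θ, ENNReal.ofReal (exp (X θ ω ^ 2 / (4 * c))) ∂μ with hF
  have hFm : Measurable F := by
    refine Measurable.lintegral_prod_left' (f := fun q : Θ × Ω =>
      ENNReal.ofReal (exp (X q.1 q.2 ^ 2 / (4 * c)))) ?_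
    fun_prop
  have hFi : ∫⁻ ω, F ω ∂P ≤ 2 := by
    rw [hF, lintegral_lintegral_swap (Measurable.aemeasurable (by
      have := hX.comp measurable_swap
      simp only [Function.comp_def, Prod.fst_swap, Prod.snd_swap] at this
      simp only [Function.uncurry_def]
      fun_prop))]
    calc _ ≤ ∫⁻ θ, 2 ∂μ := lintegral_mono fun θ => (hsub θ).lintegral_exp_sq_le (hXθ θ) hc
      _ = 2 := by simp
  -- Since `∫ F ≤ 2`, Markov's inequality bounds the probability of `F > 2 / δ` by `δ`.
  refine ⟨{ω | F ω ≤ ENNReal.ofReal (2 / δ)}, measurableSet_le hFm measurable_const, ?_, ?_⟩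
  · have hcompl : P {ω | F ω ≤ ENNReal.ofReal (2 / δ)}ᶜ ≤ ENNReal.ofReal δ := by
      calc P {ω | F ω ≤ ENNReal.ofReal (2 / δ)}ᶜ
          ≤ P {ω | ENNReal.ofReal (2 / δ) ≤ F ω} := by
            refine measure_mono fun ω hω => ?_
            simp only [Set.mem_compl_iff, Set.mem_ofPred_eq, not_le] at hω ⊢
            exact hω.le
        _ ≤ (∫⁻ ω, F ω ∂P) / ENNReal.ofReal (2 / δ) :=
            meas_ge_le_lintegral_div hFm.aemeasurable (by simp; positivity) (by simp)
        _ ≤ 2 / ENNReal.ofReal (2 / δ) := by gcongr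
        _ = ENNReal.ofReal δ := by
            rw [show (2 : ℝ≥0∞) = ENNReal.ofReal 2 by simp,
              ← ENNReal.ofReal_div_of_pos (by positivity)]
            congr 1; field_simp
    rw [prob_compl_eq_one_sub (measurableSet_le hFm measurable_const), tsub_le_iff_left] at hcompl
    rw [ENNReal.ofReal_sub _ hδ0.le, ENNReal.ofReal_one, tsub_le_iff_right]
    exact hcompl
  · intro ω hω ρ hρ hkl
    have hb : ∀ θ, ‖X θ ω‖ ≤ B := fun θ => by simpa using hB θ ω
    have hsq : ∀ θ, X θ ω ^ 2 ≤ B ^ 2 := fun θ => 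
      sq_le_sq' (abs_le.1 (hB θ ω)).1 (abs_le.1 (hB θ ω)).2
    have hi1 : Integrable (fun θ => X θ ω) ρ :=
      Integrable.of_bound (hXω ω).aestronglyMeasurable B (ae_of_all _ hb)
    have hi2 : Integrable (fun θ => X θ ω ^ 2) ρ :=
      Integrable.of_bound ((hXω ω).pow_const 2).aestronglyMeasurable (B ^ 2)
        (ae_of_all _ fun θ => by rw [Real.norm_of_nonneg (by positivity)]; exact hsq θ)
    have hi3 : Integrable (fun θ => exp (X θ ω ^ 2 / (4 * c))) μ := by
      refine Integrable.of_bound (Measurable.aestronglyMeasurable (by have := hXω ω; fun_prop))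
        (exp (B ^ 2 / (4 * c))) (ae_of_all _ fun θ => ?_)
      rw [Real.norm_of_nonneg (exp_pos _).le]
      have := hsq θ
      gcongr
    have hDV := integral_le_klDiv_add_log hkl (hi2.div_const (4 * c)) hi3
    have hlog : log (∫ θ, exp (X θ ω ^ 2 / (4 * c)) ∂μ) ≤ log (2 / δ) := by
      refine log_le_log (integral_exp_pos hi3) ?_
      have h := hω
      simp only [Set.mem_ofPred_eq, hF] at h
      rw [← ofReal_integral_eq_lintegral_ofReal hi3 (ae_of_all _ fun _ => (exp_pos _).le)] at h
      exact (ENNReal.ofReal_le_ofReal_iff (by positivity)).1 h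
    have hJ : (∫ θ, X θ ω ∂ρ) ^ 2 ≤ ∫ θ, X θ ω ^ 2 ∂ρ :=
      even_two.convexOn_pow.map_integral_le (by fun_prop) isClosed_univ (by simp) hi1 hi2
    rw [integral_div, div_le_iff₀ (by positivity)] at hDV
    refine le_sqrt_of_sq_le (hJ.trans (hDV.trans ?_))
    rw [mul_comm]
    gcongr
end

/-! ### Contraction of oscillations -/

section
open Real
open scoped NNReal

variable {X Y Z : Type*} [MeasurableSpace X] [MeasurableSpace Y] [MeasurableSpace Z]

lemma exists_mem_Icc_of_sub_le {X : Type*} [Nonempty X] {φ : X → ℝ} {d : ℝ}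
    (h : ∀ x y, φ x - φ y ≤ d) :
    ∃ a, ∀ x, φ x ∈ Set.Icc a (a + d) := by
  obtain ⟨x₀⟩ := ‹Nonempty X›
  have hb : BddBelow (Set.range φ) := ⟨φ x₀ - d, by rintro _ ⟨y, rfl⟩; linarith [h x₀ y]⟩
  refine ⟨⨅ x, φ x, fun x => ⟨ciInf_le hb x, ?_⟩⟩
  have : Nonempty X := ⟨x₀⟩
  have : φ x - d ≤ ⨅ y, φ y := le_ciInf fun y => by linarith [h x y]
  linarith

lemma integrable_of_sub_le {φ : X → ℝ} (hφ : Measurable φ) {d : ℝ} (h : ∀ x y, φ x - φ y ≤ d)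
    (μ : Measure X) [IsFiniteMeasure μ] : Integrable φ μ := by
  rcases isEmpty_or_nonempty X with hX | hX
  · rw [Measure.eq_zero_of_isEmpty μ]; exact integrable_zero_measure
  obtain ⟨a, ha⟩ := exists_mem_Icc_of_sub_le h
  exact Integrable.of_mem_Icc a (a + d) hφ.aemeasurable (ae_of_all _ ha)

/-- Total variation controls the difference of the integrals of a function of oscillation at most
`d`, by the layer cake formula. -/
lemma PacBayesRL.integral_sub_integral_le_of_tvDist_le {μ ν : Measure X} [IsProbabilityMeasure μ]
    [IsProbabilityMeasure ν] {ε : ℝ} (hε : 0 ≤ ε) (h : tvDist μ ν ≤ ENNReal.ofReal ε)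
    {φ : X → ℝ} (hφ : Measurable φ) {d : ℝ} (hd : ∀ x y, φ x - φ y ≤ d) :
    ∫ x, φ x ∂μ - ∫ x, φ x ∂ν ≤ ε * d := by
  have hX : Nonempty X := nonempty_of_isProbabilityMeasure μ
  obtain ⟨a, ha⟩ := exists_mem_Icc_of_sub_le hd
  have hd0 : 0 ≤ d := by
    obtain ⟨x⟩ := hX
    simpa using hd x x
  have htv : ∀ B : Set X, MeasurableSet B → μ.real B - ν.real B ≤ ε := by
    intro B hB
    have h1 : ENNReal.ofReal |μ.real B - ν.real B| ≤ ENNReal.ofReal ε :=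
      (le_iSup₂ (f := fun (B : Set X) (_ : MeasurableSet B) =>
        ENNReal.ofReal |μ.real B - ν.real B|) B hB).trans h
    exact (le_abs_self _).trans ((ENNReal.ofReal_le_ofReal_iff hε).1 h1)
  have key : ∀ (m : Measure X) [IsProbabilityMeasure m],
      ∫ x, φ x ∂m = a + ∫ t in Set.Ioc 0 d, m.real {x | t ≤ φ x - a} := by
    intro m _
    have h1 := Integrable.integral_eq_integral_Ioc_meas_le (f := fun x => φ x - a) (M := d)
      ((integrable_of_sub_le hφ hd m).sub (integrable_const a))
      (ae_of_all _ fun x => by simpa using (ha x).1)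
      (ae_of_all _ fun x => by simpa [add_comm] using (ha x).2)
    rw [← h1, integral_sub (integrable_of_sub_le hφ hd m) (integrable_const a)]
    simp
  have hint : ∀ (m : Measure X) [IsProbabilityMeasure m],
      IntegrableOn (fun t : ℝ => m.real {x | t ≤ φ x - a}) (Set.Ioc 0 d) := by
    intro m _
    refine Integrable.of_mem_Icc 0 1 ?_ (ae_of_all _ fun t => ⟨by positivity, measureReal_le_one⟩)
    refine Antitone.measurable (fun s t hst => ?_) |>.aemeasurable
    exact measureReal_mono (fun x (hx : t ≤ _) => hst.trans hx)
  rw [key μ, key ν, add_sub_add_left_eq_sub, ← integral_sub (hint μ) (hint ν)]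
  calc ∫ t in Set.Ioc 0 d, (μ.real {x | t ≤ φ x - a} - ν.real {x | t ≤ φ x - a})
      ≤ ∫ t in Set.Ioc 0 d, ε :=
        integral_mono ((hint μ).sub (hint ν)) (integrable_const _)
          fun t => htv _ (measurableSet_le measurable_const (hφ.sub_const a))
    _ = ε * d := by simp [hd0, mul_comm]

/-- The kernel `κ` contracts oscillations by the factor `q`: this says that its Dobrushin
coefficient is at most `q`. The oscillation of `φ` is encoded by its upper bounds `d`. -/
def OscContracting (κ : Kernel X Y) (q : ℝ) : Prop :=
  ∀ φ : Y → ℝ, Measurable φ → ∀ d, (∀ y y', φ y - φ y' ≤ d) →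
    ∀ x x', ∫ y, φ y ∂κ x - ∫ y, φ y ∂κ x' ≤ q * d

lemma OscContracting.comp {κ : Kernel X Y} {η : Kernel Y Z} [IsMarkovKernel κ] [IsMarkovKernel η]
    {p q : ℝ} (hκ : OscContracting κ p) (hη : OscContracting η q) :
    OscContracting (η ∘ₖ κ) (p * q) := by
  intro φ hφ d hd x x'
  rw [Kernel.integral_comp (integrable_of_sub_le hφ hd _),
    Kernel.integral_comp (integrable_of_sub_le hφ hd _), mul_assoc]
  exact hκ _ hφ.stronglyMeasurable.integral_kernel.measurable _ (hη φ hφ d hd) x x'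

/-- Hoeffding's lemma, for a function of oscillation at most `d`. -/
lemma lintegral_exp_mul_le_of_sub_le (ν : Measure X) [IsProbabilityMeasure ν] {φ : X → ℝ}
    (hφ : Measurable φ) {d : ℝ} (hd : ∀ x y, φ x - φ y ≤ d) (t : ℝ) :
    ∫⁻ x, ENNReal.ofReal (exp (t * φ x)) ∂ν ≤
      ENNReal.ofReal (exp (t ^ 2 * d ^ 2 / 8)) * ENNReal.ofReal (exp (t * ∫ x, φ x ∂ν)) := by
  have hX : Nonempty X := nonempty_of_isProbabilityMeasure ν
  obtain ⟨a, ha⟩ := exists_mem_Icc_of_sub_le hd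
  have h := hasSubgaussianMGF_of_mem_Icc (μ := ν) hφ.aemeasurable (ae_of_all _ ha)
  have h1 := h.mgf_le t
  have h2 := h.integrable_exp_mul t
  simp only [mgf, add_sub_cancel_left] at h1
  have h3 : ∀ x, exp (t * φ x) = exp (t * ∫ x, φ x ∂ν) * exp (t * (φ x - ∫ x, φ x ∂ν)) :=
    fun x => by rw [← exp_add]; ring_nf
  simp_rw [h3, ENNReal.ofReal_mul (exp_pos _).le]
  rw [lintegral_const_mul _ (by fun_prop), mul_comm,
    ← ofReal_integral_eq_lintegral_ofReal h2 (ae_of_all _ fun _ => (exp_pos _).le)]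
  gcongr
  refine h1.trans (le_of_eq ?_)
  congr 1
  push_cast
  rw [norm_eq_abs, div_pow, sq_abs]
  ring

/-! ### Concentration of additive functionals of a Markov chain -/

/-- `U` is a Markov chain with respect to the filtration `ℱ` and the transition kernels `κ n` from
time `n` to `n + 1`. The Markov property is stated through integrals of nonnegative functions, so
that no regular conditional distributions, hence no assumptions on the state space, are needed. -/
structure IsMarkovChain {Ω : Type*} {mΩ : MeasurableSpace Ω} (P : Measure Ω)
    (ℱ : Filtration ℕ mΩ) (U : ℕ → Ω → X) (κ : ℕ → Kernel X X) : Prop where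
  measurable : ∀ n, Measurable[ℱ n] (U n)
  lintegral_mul : ∀ n, ∀ G : Ω → ℝ≥0∞, Measurable[ℱ n] G → ∀ h : X → ℝ≥0∞, Measurable h →
    ∫⁻ ω, G ω * h (U (n + 1) ω) ∂P = ∫⁻ ω, G ω * ∫⁻ x, h x ∂κ n (U n ω) ∂P

namespace IsMarkovChain

variable {Ω : Type*} {mΩ : MeasurableSpace Ω} {P : Measure Ω} {ℱ : Filtration ℕ mΩ}
  {U : ℕ → Ω → X} {κ : ℕ → Kernel X X}

lemma measurable' (h : IsMarkovChain P ℱ U κ) (n : ℕ) : Measurable (U n) :=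
  (h.measurable n).mono (ℱ.le n) le_rfl

lemma integral_succ [IsProbabilityMeasure P] [∀ n, IsMarkovKernel (κ n)]
    (h : IsMarkovChain P ℱ U κ) (n : ℕ) {φ : X → ℝ} (hφ : Measurable φ) {d : ℝ}
    (hd : ∀ x y, φ x - φ y ≤ d) :
    ∫ ω, φ (U (n + 1) ω) ∂P = ∫ ω, ∫ x, φ x ∂κ n (U n ω) ∂P := by
  have := Measure.isProbabilityMeasure_map (μ := P) (h.measurable' n).aemeasurable
  have hlaw : P.map (U (n + 1)) = κ n ∘ₘ P.map (U n) := by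
    ext s hs
    rw [Measure.bind_apply hs (κ n).aemeasurable,
      lintegral_map ((κ n).measurable_coe hs) (h.measurable' n), ← lintegral_indicator_one hs,
      lintegral_map (measurable_one.indicator hs) (h.measurable' _)]
    have h1 := h.lintegral_mul n (fun _ => 1) measurable_const (s.indicator 1)
      (measurable_one.indicator hs)
    simpa [lintegral_indicator_one hs] using h1
  have hm := hφ.stronglyMeasurable.integral_kernel (κ := κ n)
  rw [← integral_map (h.measurable' _).aemeasurable hφ.aestronglyMeasurable, hlaw,
    ← integral_map (f := fun x => ∫ y, φ y ∂κ n x) (h.measurable' n).aemeasurable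
      hm.aestronglyMeasurable]
  have h2 := Kernel.integral_comp (κ := Kernel.const Unit (P.map (U n))) (η := κ n) (a := ())
    (integrable_of_sub_le hφ hd _)
  simpa [Kernel.comp_apply] using h2

/-- Azuma's method, run backwards in time. The function `W` is the expected remaining sum
`E[∑ w (j + l) (U (j + l)) | U j = x]`, `D` bounds its oscillation and `v` is the sum of the squares
of the analogous bounds at the later times. Going one step back replaces `D` by `a j + q * D`, and
the bound on `(1 - q) * v + D ^ 2` is an invariant of this recursion that is strong enough to give
`v + D ^ 2 ≤ (∑ a ^ 2) / (1 - q) ^ 2`. The kernels need to contract only at those times after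
which some weight is left. -/
lemma exists_lintegral_exp_sum_le [IsProbabilityMeasure P] [∀ n, IsMarkovKernel (κ n)]
    (h : IsMarkovChain P ℱ U κ) {q : ℝ} (hq0 : 0 ≤ q) (hq1 : q < 1) {w : ℕ → X → ℝ} {a : ℕ → ℝ}
    (hw : ∀ j, Measurable (w j)) (hw0 : ∀ j x, 0 ≤ w j x) (hwa : ∀ j x, w j x ≤ a j)
    (hκ : ∀ j, OscContracting (κ j) q ∨ ∀ l > j, a l = 0) (t : ℝ) (n : ℕ) : ∀ j : ℕ,
    ∃ W : X → ℝ, ∃ D v : ℝ, Measurable W ∧ (∀ x y, W x - W y ≤ D) ∧ 0 ≤ D ∧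
      ((∀ l ≥ j, a l = 0) → D = 0) ∧
      (1 - q) * v + D ^ 2 ≤ (∑ l ∈ Finset.range n, a (j + l) ^ 2) / (1 - q) ∧
      ∫ ω, W (U j ω) ∂P = ∫ ω, ∑ l ∈ Finset.range n, w (j + l) (U (j + l) ω) ∂P ∧
      ∀ G : Ω → ℝ≥0∞, Measurable[ℱ j] G →
        ∫⁻ ω, G ω * ENNReal.ofReal
            (exp (t * ∑ l ∈ Finset.range n, w (j + l) (U (j + l) ω))) ∂P ≤
          ENNReal.ofReal (exp (t ^ 2 * v / 8)) *
            ∫⁻ ω, G ω * ENNReal.ofReal (exp (t * W (U j ω))) ∂P := by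
  have hX : Nonempty X := (nonempty_of_isProbabilityMeasure P).map (U 0)
  have ha0 : ∀ j, 0 ≤ a j := fun j => (hw0 j hX.some).trans (hwa j _)
  have hwd : ∀ j x y, w j x - w j y ≤ a j := fun j x y => by linarith [hw0 j y, hwa j x]
  have hwi : ∀ j l, Integrable (fun ω => w j (U l ω)) P := fun j l =>
    integrable_of_sub_le ((hw j).comp (h.measurable' l)) (d := a j) (fun _ _ => hwd _ _ _) P
  have hq : 0 < 1 - q := by linarith
  induction n with
  | zero =>
    intro j
    exact ⟨fun _ => 0, 0, 0, measurable_const, by simp, le_rfl, fun _ => rfl, by simp, by simp,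
      fun G _ => by simp⟩
  | succ n ih =>
    intro j
    obtain ⟨W, D, v, hW, hWD, hD0, hDz, hv, hmean, hexp⟩ := ih (j + 1)
    set KW : X → ℝ := fun x => ∫ y, W y ∂κ j x with hKW
    have hKWm : Measurable KW := hW.stronglyMeasurable.integral_kernel.measurable
    have hKWd : ∀ x y, KW x - KW y ≤ q * D := by
      rcases hκ j with hc | hz
      · exact hc W hW D hWD
      · have hD : D = 0 := hDz fun l hl => hz l (by omega)
        intro x y
        obtain ⟨b, hb⟩ := exists_mem_Icc_of_sub_le hWD
        have hWb : W = fun _ => b := by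
          ext z
          have := hb z
          rw [hD, add_zero] at this
          exact le_antisymm this.2 this.1
        simp [hKW, hWb, hD]
    have hshift : ∀ ω, ∑ l ∈ Finset.range (n + 1), w (j + l) (U (j + l) ω) =
        w j (U j ω) + ∑ l ∈ Finset.range n, w (j + 1 + l) (U (j + 1 + l) ω) := fun ω => by
      rw [Finset.sum_range_succ', add_comm]
      simp only [add_zero, add_assoc, add_comm 1]
    refine ⟨fun x => w j x + KW x, a j + q * D, v + D ^ 2, (hw j).add hKWm, ?_, ?_, ?_, ?_, ?_, ?_⟩
    · intro x y
      linarith [hwd j x y, hKWd x y]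
    · have := ha0 j
      positivity
    · intro hz
      rw [hz j le_rfl, hDz fun l hl => hz l (by omega)]
      simp
    · have hsum : ∑ l ∈ Finset.range (n + 1), a (j + l) ^ 2 =
          a j ^ 2 + ∑ l ∈ Finset.range n, a (j + 1 + l) ^ 2 := by
        rw [Finset.sum_range_succ', add_comm]
        simp only [add_zero, add_assoc, add_comm 1]
      -- convexity of the square, with weights `1 - q` and `q`
      have hconv : (a j + q * D) ^ 2 ≤ a j ^ 2 / (1 - q) + q * D ^ 2 := by
        have : a j ^ 2 / (1 - q) + q * D ^ 2 - (a j + q * D) ^ 2 =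
            q / (1 - q) * (a j - (1 - q) * D) ^ 2 := by
          field_simp; ring
        have h2 : 0 ≤ q / (1 - q) * (a j - (1 - q) * D) ^ 2 := by positivity
        linarith
      rw [hsum, add_div]
      linarith
    · simp_rw [hshift]
      have hKWi : Integrable (fun ω => KW (U j ω)) P :=
        integrable_of_sub_le (hKWm.comp (h.measurable' j)) (fun _ _ => hKWd _ _) P
      rw [integral_add (hwi _ _) hKWi, integral_add (hwi _ _)
        (integrable_finsetSum _ fun l _ => hwi _ _), ← hmean, h.integral_succ j hW hWD]
    · intro G hG
      have hG1 : Measurable[ℱ j] fun ω => G ω * ENNReal.ofReal (exp (t * w j (U j ω))) := by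
        have h1 : Measurable[ℱ j] fun ω => ENNReal.ofReal (exp (t * w j (U j ω))) :=
          Measurable.comp (g := fun x => ENNReal.ofReal (exp (t * w j x)))
            (by have := hw j; fun_prop) (h.measurable j)
        exact hG.mul h1
      have hm : Measurable fun x => ENNReal.ofReal (exp (t * W x)) := by fun_prop
      have hG' : Measurable G := hG.mono (ℱ.le j) le_rfl
      have hUj := h.measurable' j
      have hwj := hw j
      calc ∫⁻ ω, G ω * ENNReal.ofReal
            (exp (t * ∑ l ∈ Finset.range (n + 1), w (j + l) (U (j + l) ω))) ∂P
          = ∫⁻ ω, (G ω * ENNReal.ofReal (exp (t * w j (U j ω)))) * ENNReal.ofReal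
            (exp (t * ∑ l ∈ Finset.range n, w (j + 1 + l) (U (j + 1 + l) ω))) ∂P := by
            refine lintegral_congr fun ω => ?_
            rw [hshift, mul_add, exp_add, ENNReal.ofReal_mul (exp_pos _).le, mul_assoc]
        _ ≤ ENNReal.ofReal (exp (t ^ 2 * v / 8)) *
            ∫⁻ ω, (G ω * ENNReal.ofReal (exp (t * w j (U j ω)))) *
              ENNReal.ofReal (exp (t * W (U (j + 1) ω))) ∂P :=
            hexp _ (hG1.mono (ℱ.mono (Nat.le_succ j)) le_rfl)
        _ = ENNReal.ofReal (exp (t ^ 2 * v / 8)) *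
            ∫⁻ ω, (G ω * ENNReal.ofReal (exp (t * w j (U j ω)))) *
              ∫⁻ x, ENNReal.ofReal (exp (t * W x)) ∂κ j (U j ω) ∂P := by
            rw [h.lintegral_mul j _ hG1 _ hm]
        _ ≤ ENNReal.ofReal (exp (t ^ 2 * v / 8)) *
            ∫⁻ ω, (G ω * ENNReal.ofReal (exp (t * w j (U j ω)))) *
              (ENNReal.ofReal (exp (t ^ 2 * D ^ 2 / 8)) *
                ENNReal.ofReal (exp (t * KW (U j ω)))) ∂P := by
            gcongr with ω
            exact lintegral_exp_mul_le_of_sub_le _ hW hWD t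
        _ = ENNReal.ofReal (exp (t ^ 2 * v / 8)) * (ENNReal.ofReal (exp (t ^ 2 * D ^ 2 / 8)) *
            ∫⁻ ω, G ω * ENNReal.ofReal (exp (t * (w j (U j ω) + KW (U j ω)))) ∂P) := by
            rw [← lintegral_const_mul (ENNReal.ofReal (exp (t ^ 2 * D ^ 2 / 8))) (by fun_prop)]
            congr 1
            refine lintegral_congr fun ω => ?_
            rw [mul_add, exp_add, ENNReal.ofReal_mul (exp_pos _).le]
            ring
        _ = _ := by
            rw [← mul_assoc, ← ENNReal.ofReal_mul (exp_pos _).le, ← exp_add]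
            congr 3
            ring

/-- An additive functional of a Markov chain whose kernels contract oscillations by `q` is
sub-Gaussian with constant `(∑ a ^ 2) / (4 * (1 - q) ^ 2)`, where the summands take values in
`[0, a l]`. -/
lemma hasSubgaussianMGF_sum [IsProbabilityMeasure P] [∀ n, IsMarkovKernel (κ n)]
    (h : IsMarkovChain P ℱ U κ) {q : ℝ} (hq0 : 0 ≤ q) (hq1 : q < 1) {w : ℕ → X → ℝ} {a : ℕ → ℝ}
    (hw : ∀ j, Measurable (w j)) (hw0 : ∀ j x, 0 ≤ w j x) (hwa : ∀ j x, w j x ≤ a j)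
    (hκ : ∀ j, OscContracting (κ j) q ∨ ∀ l > j, a l = 0) (n : ℕ) {c : ℝ≥0}
    (hc : (∑ l ∈ Finset.range n, a l ^ 2) / (4 * (1 - q) ^ 2) ≤ c) :
    HasSubgaussianMGF (fun ω => ∑ l ∈ Finset.range n, w l (U l ω) -
      ∫ ω', ∑ l ∈ Finset.range n, w l (U l ω') ∂P) c P := by
  set f : Ω → ℝ := fun ω => ∑ l ∈ Finset.range n, w l (U l ω) with hf
  have hfm : Measurable f := Finset.measurable_fun_sum _ fun l _ => (hw l).comp (h.measurable' l)
  have hf_mem : ∀ ω, f ω ∈ Set.Icc 0 (∑ l ∈ Finset.range n, a l) := fun ω =>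
    ⟨Finset.sum_nonneg fun l _ => hw0 _ _, Finset.sum_le_sum fun l _ => hwa _ _⟩
  have hq : 0 < 1 - q := by linarith
  refine ⟨(hasSubgaussianMGF_of_mem_Icc hfm.aemeasurable (ae_of_all _ hf_mem)).integrable_exp_mul,
    fun t => ?_⟩
  obtain ⟨W, D, v, hW, hWD, hD0, -, hv, hmean, hexp⟩ :=
    h.exists_lintegral_exp_sum_le hq0 hq1 hw hw0 hwa hκ t n 0
  simp only [zero_add] at hv hmean hexp
  have hvD : v + D ^ 2 ≤ 4 * c := by
    have h1 : (1 - q) * (v + D ^ 2) ≤ (∑ l ∈ Finset.range n, a l ^ 2) / (1 - q) := by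
      have : 0 ≤ q * D ^ 2 := by positivity
      linarith
    rw [div_le_iff₀ (by positivity)] at hc
    rw [le_div_iff₀ hq] at h1
    refine le_of_mul_le_mul_right ?_ (show 0 < (1 - q) ^ 2 by positivity)
    linarith
  have h1 : ∫⁻ ω, ENNReal.ofReal (exp (t * f ω)) ∂P ≤
      ENNReal.ofReal (exp (t ^ 2 * (v + D ^ 2) / 8)) * ENNReal.ofReal (exp (t * ∫ ω, f ω ∂P)) := by
    have h2 := hexp (fun _ => 1) measurable_const
    simp only [one_mul] at h2
    refine h2.trans ?_
    have h3 := lintegral_exp_mul_le_of_sub_le P (hW.comp (h.measurable' 0))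
      (fun ω ω' => hWD (U 0 ω) (U 0 ω')) t
    simp only [Function.comp_apply, hmean] at h3
    refine (mul_le_mul_right h3 _).trans (le_of_eq ?_)
    rw [← mul_assoc, ← ENNReal.ofReal_mul (exp_pos _).le, ← exp_add]
    congr 3
    ring
  have h4 : Integrable (fun ω => exp (t * f ω)) P :=
    integrable_exp_mul_of_mem_Icc hfm.aemeasurable (ae_of_all _ hf_mem)
  rw [← ofReal_integral_eq_lintegral_ofReal h4 (ae_of_all _ fun _ => (exp_pos _).le),
    ← ENNReal.ofReal_mul (exp_pos _).le, ENNReal.ofReal_le_ofReal_iff (by positivity)] at h1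
  calc mgf (fun ω => f ω - ∫ ω', f ω' ∂P) P t
      = exp (-(t * ∫ ω, f ω ∂P)) * ∫ ω, exp (t * f ω) ∂P := by
        rw [mgf, ← integral_const_mul]
        congr 1 with ω
        rw [← exp_add]; ring_nf
    _ ≤ exp (-(t * ∫ ω, f ω ∂P)) *
        (exp (t ^ 2 * (v + D ^ 2) / 8) * exp (t * ∫ ω, f ω ∂P)) := by gcongr
    _ = exp (t ^ 2 * (v + D ^ 2) / 8) := by
        rw [mul_comm, mul_assoc, ← exp_add, add_neg_cancel, exp_zero, mul_one]
    _ ≤ exp (c * t ^ 2 / 2) := by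
        refine exp_le_exp.2 ?_
        have := mul_le_mul_of_nonneg_left hvD (sq_nonneg t)
        linarith

end IsMarkovChain

lemma ProbabilityTheory.HasSubgaussianMGF.mono {Ω : Type*} {mΩ : MeasurableSpace Ω}
    {P : Measure Ω} {f : Ω → ℝ} {c c' : ℝ≥0} (h : HasSubgaussianMGF f c P) (hc : c ≤ c') :
    HasSubgaussianMGF f c' P :=
  ⟨h.integrable_exp_mul, fun t => (h.mgf_le t).trans (by gcongr)⟩

/-- No independence is assumed: by Hölder's inequality the square roots of the constants add up,
and the Cauchy–Schwarz inequality bounds the square of their sum. -/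
lemma ProbabilityTheory.HasSubgaussianMGF.sum {Ω ι : Type*} {mΩ : MeasurableSpace Ω}
    {P : Measure Ω} [IsProbabilityMeasure P] {f : ι → Ω → ℝ} {c : ι → ℝ≥0} (s : Finset ι)
    (h : ∀ i ∈ s, HasSubgaussianMGF (f i) (c i) P) :
    HasSubgaussianMGF (fun ω => ∑ i ∈ s, f i ω) (s.card * ∑ i ∈ s, c i) P := by
  have key : HasSubgaussianMGF (fun ω => ∑ i ∈ s, f i ω) ((∑ i ∈ s, (c i).sqrt) ^ 2) P := by
    classical
    induction s using Finset.induction_on with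
    | empty => simp
    | insert i s his ih =>
      simp_rw [Finset.sum_insert his]
      have h2 := (h i (Finset.mem_insert_self i s)).add
        (ih fun j hj => h j (Finset.mem_insert_of_mem hj))
      simpa using h2
  refine key.mono ?_
  have h3 := sq_sum_le_card_mul_sum_sq (s := s) (f := fun i => √(c i : ℝ))
  rw [← NNReal.coe_le_coe]
  push_cast
  refine h3.trans (le_of_eq ?_)
  simp
end

/-! ### Stability of sub-Gaussian bounds -/

section
open Filter Topology
open scoped NNReal

lemma ProbabilityTheory.HasSubgaussianMGF.of_tendsto {Ω : Type*} {mΩ : MeasurableSpace Ω}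
    {P : Measure Ω} [IsProbabilityMeasure P] {f : ℕ → Ω → ℝ} {g : Ω → ℝ} {c : ℝ≥0} {B : ℝ}
    (hf : ∀ n, Measurable (f n)) (hB : ∀ n ω, |f n ω| ≤ B)
    (hlim : ∀ ω, Tendsto (fun n => f n ω) atTop (𝓝 (g ω)))
    (h : ∀ n, HasSubgaussianMGF (f n) c P) : HasSubgaussianMGF g c P := by
  have hg : Measurable g := measurable_of_tendsto_metrizable hf (tendsto_pi_nhds.2 hlim)
  have hgB : ∀ ω, |g ω| ≤ B := fun ω =>
    le_of_tendsto (hlim ω).abs (Eventually.of_forall fun n => hB n ω)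
  refine ⟨fun t => integrable_exp_mul_of_mem_Icc hg.aemeasurable
    (ae_of_all _ fun ω => abs_le.1 (hgB ω)), fun t => ?_⟩
  refine le_of_tendsto (x := atTop) (f := fun n => mgf (f n) P t) ?_
    (Eventually.of_forall fun n => (h n).mgf_le t)
  refine tendsto_integral_of_dominated_convergence (fun _ => Real.exp (|t| * B))
    (fun n => by have := hf n; fun_prop) (integrable_const _) (fun n => ae_of_all _ fun ω => ?_)
    (ae_of_all _ fun ω => ?_)
  · rw [Real.norm_of_nonneg (Real.exp_pos _).le]
    refine Real.exp_le_exp.2 ((le_abs_self _).trans ?_)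
    rw [abs_mul]
    exact mul_le_mul_of_nonneg_left (hB n ω) (abs_nonneg t)
  · exact (Real.continuous_exp.tendsto _).comp ((hlim ω).const_mul t)

lemma ProbabilityTheory.HasSubgaussianMGF.of_forall_lt {Ω : Type*} {mΩ : MeasurableSpace Ω}
    {P : Measure Ω} {f : Ω → ℝ} {c : ℝ≥0} (h : ∀ c' > c, HasSubgaussianMGF f c' P) :
    HasSubgaussianMGF f c P := by
  refine ⟨(h (c + 1) (by simp)).integrable_exp_mul, fun t => ?_⟩
  have hcont : Continuous fun x : ℝ≥0 => Real.exp (x * t ^ 2 / 2) := by fun_prop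
  exact ge_of_tendsto ((hcont.tendsto c).mono_left (nhdsWithin_le_nhds (s := Set.Ioi c)))
    (eventually_nhdsWithin_of_forall fun x hx => (h x hx).mgf_le t)

lemma ProbabilityTheory.HasSubgaussianMGF.map {Ω Ω' : Type*} {mΩ : MeasurableSpace Ω}
    {mΩ' : MeasurableSpace Ω'} {P : Measure Ω} {g : Ω → Ω'} (hg : Measurable g) {f : Ω' → ℝ}
    (hf : Measurable f) {c : ℝ≥0} (h : HasSubgaussianMGF (f ∘ g) c P) :
    HasSubgaussianMGF f c (P.map g) := by
  have hm : ∀ t : ℝ, AEStronglyMeasurable (fun ω => Real.exp (t * f ω)) (P.map g) := fun t =>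
    Measurable.aestronglyMeasurable (by fun_prop)
  refine ⟨fun t => ?_, fun t => ?_⟩
  · rw [integrable_map_measure (hm t) hg.aemeasurable]
    exact h.integrable_exp_mul t
  · rw [mgf_map hg.aemeasurable (hm t)]
    exact h.mgf_le t
end

/-! ### The Markov chain of a policy -/

namespace PacBayesRL

section
open Filter Topology
open scoped NNReal

variable {S A : Type*} [MeasurableSpace S] [MeasurableSpace A] {Rmax : ℝ}
  (M : MDP S A Rmax) (p : Policy S A)

instance : IsProbabilityMeasure (initStep M p) := by
  unfold initStep; infer_instance

instance : IsProbabilityMeasure (chainLaw M p) := by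
  unfold chainLaw; infer_instance

instance (H : ℕ∞) : IsProbabilityMeasure (trajLaw M p H) :=
  Measure.isProbabilityMeasure_map (measurable_pi_lambda _ fun i =>
    measurable_pi_apply i.1).aemeasurable

instance (i t : ℕ) : IsMarkovKernel (lagKernel M p i t) := by
  induction t with
  | zero => unfold lagKernel; infer_instance
  | succ t ih => unfold lagKernel; infer_instance

lemma lagKernel_add (i s t : ℕ) :
    lagKernel M p i (s + t) = lagKernel M p (i + s) t ∘ₖ lagKernel M p i s := by
  induction t with
  | zero => simp [lagKernel]
  | succ t ih =>
    rw [← add_assoc, lagKernel, ih, lagKernel, Kernel.comp_assoc, add_assoc]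

lemma isMarkovChain_chainLaw :
    IsMarkovChain (chainLaw M p) Filtration.piLE (fun n ξ => ξ n) (stepKernel M p) := by
  refine ⟨fun n => ?_, fun n G hG h hh => ?_⟩
  · rw [Filtration.piLE_eq_comap_frestrictLe]
    exact (measurable_pi_apply (⟨n, Finset.mem_Iic.2 le_rfl⟩ : Finset.Iic n)).comp
      (comap_measurable (Preorder.frestrictLe n))
  · rw [Filtration.piLE_eq_comap_frestrictLe] at hG
    obtain ⟨g, hg, rfl⟩ := hG.exists_eq_measurable_comp
    have hlaw := Kernel.map_frestrictLe_trajMeasure_compProd_eq_map_trajMeasure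
      (X := fun _ => Step S A Rmax) (μ₀ := initStep M p)
      (κ := fun n => (stepKernel M p n).comap (fun x => x ⟨n, Finset.mem_Iic.2 le_rfl⟩)
        (measurable_pi_apply _)) (a := n)
    change (chainLaw M p).map _ ⊗ₘ _ = (chainLaw M p).map _ at hlaw
    have hm : Measurable fun z : ((i : Finset.Iic n) → Step S A Rmax) × Step S A Rmax =>
        g z.1 * h z.2 := by fun_prop
    calc ∫⁻ ξ, g (Preorder.frestrictLe n ξ) * h (ξ (n + 1)) ∂chainLaw M p
        = ∫⁻ z, g z.1 * h z.2 ∂(chainLaw M p).map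
            (fun ξ => (Preorder.frestrictLe n ξ, ξ (n + 1))) := by
          rw [lintegral_map hm (by fun_prop)]
      _ = ∫⁻ ξ, g (Preorder.frestrictLe n ξ) *
            ∫⁻ x, h x ∂stepKernel M p n (ξ n) ∂chainLaw M p := by
          rw [← hlaw, Measure.lintegral_compProd hm, lintegral_map (by fun_prop) (by fun_prop)]
          refine lintegral_congr fun ξ => ?_
          exact lintegral_const_mul (μ := stepKernel M p n (ξ n)) (g (Preorder.frestrictLe n ξ)) hh

lemma lintegral_mul_lagKernel (i t : ℕ) {G : (ℕ → Step S A Rmax) → ℝ≥0∞}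
    (hG : Measurable[Filtration.piLE (X := fun _ => Step S A Rmax) i] G)
    {h : Step S A Rmax → ℝ≥0∞} (hh : Measurable h) :
    ∫⁻ ξ, G ξ * h (ξ (i + t)) ∂chainLaw M p =
      ∫⁻ ξ, G ξ * ∫⁻ x, h x ∂lagKernel M p i t (ξ i) ∂chainLaw M p := by
  induction t generalizing h with
  | zero =>
    refine lintegral_congr fun ξ => ?_
    simp [lagKernel, Kernel.id_apply, lintegral_dirac' _ hh]
  | succ t ih =>
    rw [← add_assoc, (isMarkovChain_chainLaw M p).lintegral_mul (i + t) G
      (hG.mono (Filtration.piLE.mono (by omega)) le_rfl) h hh, ih hh.lintegral_kernel]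
    simp_rw [lagKernel, Kernel.lintegral_comp _ _ _ hh]

/-- The chain observed at the times `r, r + k, r + 2k, …` is a Markov chain with the `k`-step
kernels. -/
lemma isMarkovChain_subsample (r k : ℕ) :
    IsMarkovChain (chainLaw M p)
      { seq := fun j => Filtration.piLE (X := fun _ : ℕ => Step S A Rmax) (r + j * k)
        mono' := fun _ _ hij => Filtration.piLE.mono (by gcongr)
        le' := fun _ => Filtration.piLE.le _ }
      (fun j ξ => ξ (r + j * k)) (fun j => lagKernel M p (r + j * k) k) := by
  refine ⟨fun j => (isMarkovChain_chainLaw M p).measurable _, fun j G hG h hh => ?_⟩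
  rw [← lintegral_mul_lagKernel M p _ _ hG hh]
  refine lintegral_congr fun ξ => ?_
  rw [add_mul, one_mul, add_assoc]

lemma Rmax_nonneg (M : MDP S A Rmax) (p : Policy S A) : 0 ≤ Rmax := by
  obtain ⟨x⟩ := nonempty_of_isProbabilityMeasure (initStep M p)
  exact x.2.2.2.1.trans x.2.2.2.2

/-! ### Discounted returns -/

/-- The weight `γ ^ h` of the reward at time `h`, extended by `0` to the times beyond the horizon,
so that returns become sums over all of `ℕ`. -/
def discountWeight (γ : ℝ) (H : ℕ∞) (h : ℕ) : ℝ := if (h : ℕ∞) < H then γ ^ h else 0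

lemma discountWeight_nonneg (H : ℕ∞) (h : ℕ) : 0 ≤ discountWeight M.γ H h := by
  have := M.γ_pos
  unfold discountWeight; split_ifs <;> positivity

lemma discountWeight_le (H : ℕ∞) (h : ℕ) : discountWeight M.γ H h ≤ M.γ ^ h := by
  have := M.γ_pos
  unfold discountWeight; split_ifs
  · exact le_rfl
  · positivity

lemma sum_discountWeight_sq_le (H : ℕ∞) (n : ℕ) :
    ∑ h ∈ Finset.range n, discountWeight M.γ H h ^ 2 ≤
      (1 - powTwoHorizon M.γ H) / (1 - M.γ ^ 2) := by
  have h0 := M.γ_pos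
  have h1 := M.γ_lt_one
  have hg1 : M.γ ^ 2 < 1 := by nlinarith
  have hsq : ∀ h, discountWeight M.γ H h ^ 2 ≤ (M.γ ^ 2) ^ h := fun h => by
    rw [← pow_mul, mul_comm, pow_mul]
    exact pow_le_pow_left₀ (discountWeight_nonneg M H h) (discountWeight_le M H h) 2
  unfold powTwoHorizon
  split_ifs with hH
  · calc ∑ h ∈ Finset.range n, discountWeight M.γ H h ^ 2
        ≤ ∑ h ∈ Finset.range n, (M.γ ^ 2) ^ h := Finset.sum_le_sum fun h _ => hsq h
      _ ≤ ∑' h, (M.γ ^ 2) ^ h :=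
        (summable_geometric_of_lt_one (by positivity) hg1).sum_le_tsum _ fun _ _ => by positivity
      _ = (1 - 0) / (1 - M.γ ^ 2) := by
        rw [tsum_geometric_of_lt_one (by positivity) hg1, sub_zero, one_div]
  · lift H to ℕ using hH
    calc ∑ h ∈ Finset.range n, discountWeight M.γ H h ^ 2
        ≤ ∑ h ∈ Finset.range n, if h ∈ Finset.range H then (M.γ ^ 2) ^ h else 0 := by
          refine Finset.sum_le_sum fun h _ => ?_
          split_ifs with hh
          · exact hsq h
          · have : ¬ (h : ℕ∞) < H := by simpa using hh
            simp [discountWeight, this]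
      _ = ∑ h ∈ Finset.range n ∩ Finset.range H, (M.γ ^ 2) ^ h := by
          rw [← Finset.sum_filter, Finset.filter_mem_eq_inter]
      _ ≤ ∑ h ∈ Finset.range H, (M.γ ^ 2) ^ h :=
          Finset.sum_le_sum_of_subset_of_nonneg Finset.inter_subset_right
            fun _ _ _ => by positivity
      _ = (1 - M.γ ^ (2 * (H : ℕ∞).toNat)) / (1 - M.γ ^ 2) := by
          rw [geom_sum_eq hg1.ne, pow_mul, ← neg_div_neg_eq]
          simp

lemma ret_restrict {S A : Type*} {Rmax : ℝ} (H : ℕ∞) (γ : ℝ) (ξ : ℕ → Step S A Rmax) :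
    ret γ (fun i : Times H => ξ i.1) = ∑' h, discountWeight γ H h * ((ξ h).2.2 : ℝ) := by
  unfold ret
  refine (tsum_subtype {h : ℕ | (h : ℕ∞) < H} fun h => γ ^ h * ((ξ h).2.2 : ℝ)).trans ?_
  refine tsum_congr fun h => ?_
  by_cases hh : (h : ℕ∞) < H <;> simp [Set.indicator, discountWeight, hh]

lemma measurable_ret (H : ℕ∞) (γ : ℝ) : Measurable (ret γ : Traj S A Rmax H → ℝ) := by
  unfold ret
  exact Measurable.tsum fun h => by fun_prop

lemma ret_mem_Icc (hR : 0 ≤ Rmax) (H : ℕ∞) (ξ : Traj S A Rmax H) :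
    ret M.γ ξ ∈ Set.Icc 0 (Rmax / (1 - M.γ)) := by
  have h0 := M.γ_pos
  have hsum : Summable fun h : ℕ => M.γ ^ h * Rmax :=
    (summable_geometric_of_lt_one h0.le M.γ_lt_one).mul_right Rmax
  have hterm : ∀ h : Times H, M.γ ^ h.1 * ((ξ h).2.2 : ℝ) ≤ M.γ ^ h.1 * Rmax := fun h =>
    mul_le_mul_of_nonneg_left (ξ h).2.2.2.2 (by positivity)
  have hnn : ∀ h : Times H, 0 ≤ M.γ ^ h.1 * ((ξ h).2.2 : ℝ) := fun h =>
    mul_nonneg (by positivity) (ξ h).2.2.2.1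
  have hsub : Summable fun h : Times H => M.γ ^ h.1 * Rmax := hsum.subtype {h : ℕ | (h : ℕ∞) < H}
  refine ⟨tsum_nonneg hnn, ?_⟩
  calc ret M.γ ξ ≤ ∑' h : Times H, M.γ ^ h.1 * Rmax :=
        (hsub.of_nonneg_of_le hnn hterm).tsum_le_tsum hterm hsub
    _ ≤ ∑' h : ℕ, M.γ ^ h * Rmax :=
        hsum.tsum_subtype_le _ {h : ℕ | (h : ℕ∞) < H} (fun _ => by positivity)
    _ = Rmax / (1 - M.γ) := by
        rw [tsum_mul_right, tsum_geometric_of_lt_one h0.le M.γ_lt_one, inv_mul_eq_div]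

/-! ### Mixing times and concentration of the return -/

/-- The condition defining the mixing time: the chain forgets its state within `t` steps, up to
`ε` in total variation. -/
def MixesIn (H : ℕ∞) (ε : ℝ) (t : ℕ) : Prop :=
  ∀ i : ℕ, ((i + t : ℕ) : ℕ∞) < H → ∀ x y : Step S A Rmax,
    tvDist (lagKernel M p i t x) (lagKernel M p i t y) ≤ ENNReal.ofReal ε

variable {M p}

lemma MixesIn.oscContracting_two_mul {H : ℕ∞} {ε : ℝ} {t : ℕ} (hε : 0 ≤ ε)
    (h : MixesIn M p H ε t) {i : ℕ} (hi : ((i + 2 * t : ℕ) : ℕ∞) < H) :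
    OscContracting (lagKernel M p i (2 * t)) (ε ^ 2) := by
  have key : ∀ j : ℕ, j ≤ i + t → OscContracting (lagKernel M p j t) ε := by
    intro j hj φ hφ d hd x y
    refine integral_sub_integral_le_of_tvDist_le hε (h j (lt_of_le_of_lt ?_ hi) x y) hφ hd
    exact_mod_cast (by omega : j + t ≤ i + 2 * t)
  rw [two_mul, lagKernel_add, sq]
  exact (key i (by omega)).comp (key (i + t) le_rfl)

/-- Mixing in `0` steps forces the rewards to be constant: the point masses at `x` and `y` then
do not separate any measurable set. -/
lemma MixesIn.reward_eq {H : ℕ∞} {ε : ℝ} (hε0 : 0 ≤ ε) (hε1 : ε < 1) (h : MixesIn M p H ε 0)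
    (hH : 0 < H) (x y : Step S A Rmax) : x.2.2 = y.2.2 := by
  by_contra hne
  have hB : MeasurableSet {z : Step S A Rmax | z.2.2 = x.2.2} :=
    measurableSet_eq_fun (by fun_prop) measurable_const
  have h1 : ENNReal.ofReal |(lagKernel M p 0 0 x).real {z | z.2.2 = x.2.2} -
      (lagKernel M p 0 0 y).real {z | z.2.2 = x.2.2}| ≤ ENNReal.ofReal ε :=
    (le_iSup₂ (f := fun (B : Set (Step S A Rmax)) (_ : MeasurableSet B) => ENNReal.ofReal
      |(lagKernel M p 0 0 x).real B - (lagKernel M p 0 0 y).real B|) _ hB).trans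
      (h 0 (by simpa using hH) x y)
  rw [ENNReal.ofReal_le_ofReal_iff hε0] at h1
  have h2 : (lagKernel M p 0 0 x).real {z | z.2.2 = x.2.2} = 1 := by
    simp [lagKernel, Kernel.id_apply, Measure.real, Measure.dirac_apply' _ hB]
  have h3 : (lagKernel M p 0 0 y).real {z | z.2.2 = x.2.2} = 0 := by
    simp [lagKernel, Kernel.id_apply, Measure.real, Measure.dirac_apply' _ hB, Ne.symm hne]
  rw [h2, h3] at h1
  norm_num at h1
  linarith

lemma _root_.Finset.sum_range_mul_eq_sum_sum {α : Type*} [AddCommMonoid α] (f : ℕ → α) (k n : ℕ) :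
    ∑ h ∈ Finset.range (n * k), f h =
      ∑ r ∈ Finset.range k, ∑ j ∈ Finset.range n, f (r + j * k) := by
  induction n with
  | zero => simp
  | succ n ih =>
    simp_rw [Finset.sum_range_succ, Finset.sum_add_distrib]
    rw [← ih, add_mul, one_mul, Finset.sum_range_add]
    simp_rw [add_comm (n * k)]

/-- Partial sums of the return. The residue classes modulo `2t` are chains that contract by `ε ^ 2`;
their sub-Gaussian bounds are added without independence. With `2t` in place of `t` the constant
is half of `τ(ε) ((2 - ε) / (1 - ε)) ^ 2 * ∑ (γ ^ h * Rmax) ^ 2 / 4` or less, because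
`2 ≤ (1 + ε) * (2 - ε)`. -/
lemma MixesIn.hasSubgaussianMGF_sum {H : ℕ∞} {ε : ℝ} {t : ℕ} (hε0 : 0 ≤ ε) (hε1 : ε < 1)
    (h : MixesIn M p H ε t) (n : ℕ) {K : ℝ≥0}
    (hK : t * ((2 - ε) / (1 - ε)) ^ 2 *
      (Rmax ^ 2 * ((1 - powTwoHorizon M.γ H) / (1 - M.γ ^ 2)) / 8) ≤ K) :
    HasSubgaussianMGF (fun ξ => ∑ h ∈ Finset.range (n * (2 * t)),
        discountWeight M.γ H h * ((ξ h).2.2 : ℝ) -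
      ∫ ξ', ∑ h ∈ Finset.range (n * (2 * t)),
        discountWeight M.γ H h * ((ξ' h).2.2 : ℝ) ∂chainLaw M p) K (chainLaw M p) := by
  set k := 2 * t with hk
  have hR := Rmax_nonneg M p
  have hq : ε ^ 2 < 1 := by nlinarith
  have h1ε : 0 < 1 - ε := by linarith
  set w : ℕ → ℕ → Step S A Rmax → ℝ := fun r j x =>
    discountWeight M.γ H (r + j * k) * (x.2.2 : ℝ) with hw
  set a : ℕ → ℕ → ℝ := fun r j => discountWeight M.γ H (r + j * k) * Rmax with ha
  have hwm : ∀ r j, Measurable (w r j) := fun r j => by fun_prop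
  set c : ℕ → ℝ≥0 := fun r => NNReal.mk ((∑ l ∈ Finset.range n, a r l ^ 2) / (4 * (1 - ε ^ 2) ^ 2))
    (by positivity) with hc
  have hclass : ∀ r ∈ Finset.range k, HasSubgaussianMGF (fun ξ =>
      ∑ l ∈ Finset.range n, w r l (ξ (r + l * k)) -
        ∫ ξ', ∑ l ∈ Finset.range n, w r l (ξ' (r + l * k)) ∂chainLaw M p) (c r)
      (chainLaw M p) := by
    intro r _
    refine (isMarkovChain_subsample M p r k).hasSubgaussianMGF_sum (q := ε ^ 2) (a := a r)
      (by positivity) hq (hwm r)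
      (fun j x => mul_nonneg (discountWeight_nonneg M H _) x.2.2.2.1)
      (fun j x => mul_le_mul_of_nonneg_left x.2.2.2.2 (discountWeight_nonneg M H _))
      (fun j => ?_) n le_rfl
    by_cases hj : ((r + j * k + 2 * t : ℕ) : ℕ∞) < H
    · exact Or.inl (h.oscContracting_two_mul hε0 hj)
    -- beyond the horizon the mixing condition says nothing, but the weights vanish
    · refine Or.inr fun l hl => ?_
      have hle : r + j * k + 2 * t ≤ r + l * k := by
        have : (j + 1) * k ≤ l * k := Nat.mul_le_mul_right k hl
        rw [← hk]; linarith
      have hlt : ¬ ((r + l * k : ℕ) : ℕ∞) < H := fun hlt =>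
        hj (lt_of_le_of_lt (by exact_mod_cast hle) hlt)
      simp only [ha, discountWeight, if_neg hlt, zero_mul]
  have hsum := (HasSubgaussianMGF.sum (Finset.range k) hclass).mono (c' := K) ?_
  · refine hsum.congr (ae_of_all _ fun ξ => ?_)
    have hint : ∀ r ∈ Finset.range k, Integrable (fun ξ : ℕ → Step S A Rmax =>
        ∑ l ∈ Finset.range n, w r l (ξ (r + l * k))) (chainLaw M p) := fun r _ => by
      refine integrable_finsetSum _ fun l _ => Integrable.of_mem_Icc 0 (a r l) ?_ (ae_of_all _
        fun ξ => ⟨mul_nonneg (discountWeight_nonneg M H _) (ξ _).2.2.2.1,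
          mul_le_mul_of_nonneg_left (ξ _).2.2.2.2 (discountWeight_nonneg M H _)⟩)
      exact ((hwm r l).comp (measurable_pi_apply (r + l * k))).aemeasurable
    simp only [Finset.sum_range_mul_eq_sum_sum _ k n]
    rw [integral_finsetSum _ hint, Finset.sum_sub_distrib]
  · rw [← NNReal.coe_le_coe]
    push_cast
    refine le_trans ?_ hK
    have hA : ∑ r ∈ Finset.range k, (c r : ℝ) =
        Rmax ^ 2 * (∑ h ∈ Finset.range (n * k), discountWeight M.γ H h ^ 2) /
          (4 * (1 - ε ^ 2) ^ 2) := by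
      rw [Finset.sum_range_mul_eq_sum_sum _ k n, Finset.mul_sum, Finset.sum_div]
      refine Finset.sum_congr rfl fun r _ => ?_
      simp only [hc, ha, NNReal.coe_mk, mul_pow, ← Finset.sum_mul]
      rw [mul_comm (Rmax ^ 2)]
    rw [hA, Finset.card_range]
    set C := (1 - powTwoHorizon M.γ H) / (1 - M.γ ^ 2) with hC
    have hC1 := sum_discountWeight_sq_le M H (n * k)
    rw [← hC] at hC1
    have hC0 : 0 ≤ C := le_trans (Finset.sum_nonneg fun _ _ => sq_nonneg _) hC1
    have hconst : 2 / (4 * (1 - ε ^ 2) ^ 2) ≤ ((2 - ε) / (1 - ε)) ^ 2 / 8 := by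
      have h2 : 2 ≤ (1 + ε) * (2 - ε) := by nlinarith
      have h4 : 4 ≤ ((1 + ε) * (2 - ε)) ^ 2 := by nlinarith
      have hfac : 1 - ε ^ 2 = (1 - ε) * (1 + ε) := by ring
      rw [hfac, div_pow, div_div, div_le_div_iff₀ (by positivity) (by positivity)]
      have := mul_le_mul_of_nonneg_right h4 (show 0 ≤ 4 * (1 - ε) ^ 2 by positivity)
      nlinarith [this]
    calc (k : ℝ) * (Rmax ^ 2 * (∑ h ∈ Finset.range (n * k), discountWeight M.γ H h ^ 2) /
          (4 * (1 - ε ^ 2) ^ 2))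
        ≤ (k : ℝ) * (Rmax ^ 2 * C / (4 * (1 - ε ^ 2) ^ 2)) := by gcongr
      _ = t * (Rmax ^ 2 * C) * (2 / (4 * (1 - ε ^ 2) ^ 2)) := by
          rw [hk]; push_cast; ring
      _ ≤ t * (Rmax ^ 2 * C) * (((2 - ε) / (1 - ε)) ^ 2 / 8) := by gcongr
      _ = _ := by ring

lemma MixesIn.hasSubgaussianMGF_ret {H : ℕ∞} {ε : ℝ} {t : ℕ} (hε0 : 0 ≤ ε) (hε1 : ε < 1)
    (h : MixesIn M p H ε t) {K : ℝ≥0}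
    (hK : t * ((2 - ε) / (1 - ε)) ^ 2 *
      (Rmax ^ 2 * ((1 - powTwoHorizon M.γ H) / (1 - M.γ ^ 2)) / 8) ≤ K) :
    HasSubgaussianMGF (fun ξ => ret M.γ ξ - value M p H) K (trajLaw M p H) := by
  have hR := Rmax_nonneg M p
  have hrestr : Measurable fun (ξ : ℕ → Step S A Rmax) (i : Times H) => ξ i.1 :=
    measurable_pi_lambda _ fun i => measurable_pi_apply i.1
  have hret := measurable_ret (S := S) (A := A) (Rmax := Rmax) H M.γ
  refine HasSubgaussianMGF.map hrestr (hret.sub_const _) ?_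
  have hval : value M p H =
      ∫ ξ, ∑' h, discountWeight M.γ H h * ((ξ h).2.2 : ℝ) ∂chainLaw M p := by
    rw [value, trajLaw, integral_map hrestr.aemeasurable hret.aestronglyMeasurable]
    simp_rw [ret_restrict]
  simp only [Function.comp_def, ret_restrict, hval]
  rcases Nat.eq_zero_or_pos t with rfl | ht
  · have hconst : ∀ ξ ξ' : ℕ → Step S A Rmax,
        ∑' h, discountWeight M.γ H h * ((ξ h).2.2 : ℝ) =
          ∑' h, discountWeight M.γ H h * ((ξ' h).2.2 : ℝ) := fun ξ ξ' => by
      refine tsum_congr fun j => ?_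
      unfold discountWeight
      split_ifs with hj
      · rw [h.reward_eq hε0 hε1 (lt_of_le_of_lt zero_le hj) (ξ j) (ξ' j)]
      · simp
    refine (HasSubgaussianMGF.fun_zero.congr (ae_of_all _ fun ξ => ?_)).mono zero_le
    rw [integral_congr_ae (ae_of_all _ fun ξ' => hconst ξ' ξ)]
    simp
  have hsum : Summable fun h : ℕ => M.γ ^ h * Rmax :=
    (summable_geometric_of_lt_one M.γ_pos.le M.γ_lt_one).mul_right Rmax
  have hterm : ∀ (ξ : ℕ → Step S A Rmax) (h : ℕ),
      discountWeight M.γ H h * ((ξ h).2.2 : ℝ) ≤ M.γ ^ h * Rmax := fun ξ h =>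
    mul_le_mul (discountWeight_le M H h) (ξ h).2.2.2.2 (ξ h).2.2.2.1
      (by have := M.γ_pos; positivity)
  have hnn : ∀ (ξ : ℕ → Step S A Rmax) (h : ℕ),
      0 ≤ discountWeight M.γ H h * ((ξ h).2.2 : ℝ) := fun ξ h =>
    mul_nonneg (discountWeight_nonneg M H h) (ξ h).2.2.2.1
  set f : ℕ → (ℕ → Step S A Rmax) → ℝ := fun n ξ =>
    ∑ h ∈ Finset.range (n * (2 * t)), discountWeight M.γ H h * ((ξ h).2.2 : ℝ) with hf
  set B := ∑' h : ℕ, M.γ ^ h * Rmax with hB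
  have hγ := M.γ_pos
  have hfm : ∀ n, Measurable (f n) := fun n => by fun_prop
  have hfB : ∀ n ξ, |f n ξ| ≤ B := fun n ξ => by
    rw [abs_of_nonneg (Finset.sum_nonneg fun h _ => hnn ξ h)]
    exact (Finset.sum_le_sum fun h _ => hterm ξ h).trans
      (hsum.sum_le_tsum _ fun _ _ => by positivity)
  have hflim : ∀ ξ, Tendsto (fun n => f n ξ) atTop
      (𝓝 (∑' h, discountWeight M.γ H h * ((ξ h).2.2 : ℝ))) := fun ξ =>
    (hsum.of_nonneg_of_le (hnn ξ) (hterm ξ)).hasSum.tendsto_sum_nat.comp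
      (tendsto_id.atTop_mul_const' (by omega : 0 < 2 * t))
  have hmean : Tendsto (fun n => ∫ ξ, f n ξ ∂chainLaw M p) atTop
      (𝓝 (∫ ξ, ∑' h, discountWeight M.γ H h * ((ξ h).2.2 : ℝ) ∂chainLaw M p)) :=
    tendsto_integral_of_dominated_convergence (fun _ => B)
      (fun n => (hfm n).aestronglyMeasurable) (integrable_const _)
      (fun n => ae_of_all _ fun ξ => hfB n ξ) (ae_of_all _ hflim)
  have hmB : ∀ n, |∫ ξ, f n ξ ∂chainLaw M p| ≤ B := fun n => by
    have := norm_integral_le_of_norm_le_const (μ := chainLaw M p) (f := f n)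
      (ae_of_all _ fun ξ => hfB n ξ)
    simpa using this
  refine HasSubgaussianMGF.of_tendsto (f := fun n ξ => f n ξ - ∫ ξ', f n ξ' ∂chainLaw M p)
    (B := B + B) (fun n => (hfm n).sub_const _)
    (fun n ξ => (abs_sub _ _).trans (add_le_add (hfB n ξ) (hmB n)))
    (fun ξ => (hflim ξ).sub hmean) (fun n => h.hasSubgaussianMGF_sum hε0 hε1 n hK)

lemma exists_mixesIn_of_tauMin_lt {H : ℕ∞} {x : ℝ≥0∞} (hx : tauMin M p H < x) :
    ∃ ε t, 0 ≤ ε ∧ ε < 1 ∧ MixesIn M p H ε t ∧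
      (t : ℝ≥0∞) * ENNReal.ofReal (((2 - ε) / (1 - ε)) ^ 2) < x := by
  simp only [tauMin, iInf_lt_iff] at hx
  obtain ⟨ε, ⟨hε0, hε1⟩, hlt⟩ := hx
  have hpos : 0 < ((2 - ε) / (1 - ε)) ^ 2 := by
    have : 0 < (2 - ε) / (1 - ε) := div_pos (by linarith) (by linarith)
    positivity
  have hne : ENNReal.ofReal (((2 - ε) / (1 - ε)) ^ 2) ≠ 0 := (ENNReal.ofReal_pos.2 hpos).ne'
  rw [← ENNReal.lt_div_iff_mul_lt (Or.inl hne) (by simp)] at hlt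
  simp only [mixingTime, iInf_lt_iff] at hlt
  obtain ⟨t, ht, htx⟩ := hlt
  exact ⟨ε, t, hε0, hε1, ht, (ENNReal.lt_div_iff_mul_lt (Or.inl hne) (by simp)).1 htx⟩

/-- The bounds obtained from all pairs `(ε, t)` pass to their infimum. -/
lemma hasSubgaussianMGF_ret {H : ℕ∞} {τ : ℝ≥0} (hτ : tauMin M p H ≤ τ) {K : ℝ≥0}
    (hK : (K : ℝ) =
      τ * (Rmax ^ 2 * ((1 - powTwoHorizon M.γ H) / (1 - M.γ ^ 2)) / 8)) :
    HasSubgaussianMGF (fun ξ => ret M.γ ξ - value M p H) K (trajLaw M p H) := by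
  set C := Rmax ^ 2 * ((1 - powTwoHorizon M.γ H) / (1 - M.γ ^ 2)) / 8 with hC
  have hC0 : 0 ≤ C := by
    have h1 : 0 ≤ (1 - powTwoHorizon M.γ H) / (1 - M.γ ^ 2) := by
      simpa using sum_discountWeight_sq_le M H 0
    positivity
  refine HasSubgaussianMGF.of_forall_lt fun K' hK' => ?_
  obtain ⟨τ', hττ', hτ'K⟩ : ∃ τ' : ℝ≥0, τ < τ' ∧ τ' * C ≤ K' := by
    rcases hC0.eq_or_lt with h0 | hpos
    · exact ⟨τ + 1, by simp, by rw [← h0]; simp⟩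
    · clear_value C
      lift C to ℝ≥0 using hC0
      have hC' : C ≠ 0 := fun h => by simp [h] at hpos
      refine ⟨K' / C, ?_, ?_⟩
      · rw [lt_div_iff₀ (by exact_mod_cast hpos)]
        refine lt_of_eq_of_lt ?_ hK'
        exact_mod_cast hK.symm
      · rw [NNReal.coe_div, div_mul_cancel₀ _ hpos.ne']
  obtain ⟨ε, t, hε0, hε1, hmix, hlt⟩ := exists_mixesIn_of_tauMin_lt
    (hτ.trans_lt (ENNReal.coe_lt_coe.2 hττ'))
  refine hmix.hasSubgaussianMGF_ret hε0 hε1 (le_trans ?_ hτ'K)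
  gcongr
  have h2 := ENNReal.toReal_mono ENNReal.coe_ne_top hlt.le
  rwa [ENNReal.toReal_mul, ENNReal.toReal_ofReal (by positivity), ENNReal.toReal_natCast,
    ENNReal.coe_toReal] at h2

lemma map_eval_sampleLaw (M : MDP S A Rmax) (p : Policy S A) (H : ℕ∞) {T : ℕ} (j : Fin T) :
    (sampleLaw M p H T).map (fun D => D j) = trajLaw M p H :=
  (measurePreserving_eval (fun _ => trajLaw M p H) j).map_eq

lemma hasSubgaussianMGF_trueLoss_sub_empLoss {H : ℕ∞} {T : ℕ} (hT : 0 < T) {K : ℝ≥0}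
    (h : HasSubgaussianMGF (fun ξ => ret M.γ ξ - value M p H) K (trajLaw M p H)) :
    HasSubgaussianMGF (fun D => trueLoss M p H - empLoss M.γ D) (K / T) (sampleLaw M p H T) := by
  have hret := measurable_ret (S := S) (A := A) (Rmax := Rmax) H M.γ
  have hind : iIndepFun (fun (j : Fin T) D => ret M.γ (D j) - value M p H)
      (sampleLaw M p H T) :=
    iIndepFun_pi (X := fun _ ξ => ret M.γ ξ - value M p H) fun _ => by fun_prop
  have hj : ∀ j ∈ (Finset.univ : Finset (Fin T)), HasSubgaussianMGF
      (fun D : Fin T → Traj S A Rmax H => ret M.γ (D j) - value M p H) K (sampleLaw M p H T) :=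
    fun j _ => HasSubgaussianMGF.of_map (Y := fun D : Fin T → Traj S A Rmax H => D j)
      (X := fun ξ => ret M.γ ξ - value M p H) (measurable_pi_apply j).aemeasurable
      (by rwa [map_eval_sampleLaw])
  have hT' : (T : ℝ) ≠ 0 := by positivity
  have hmul := (HasSubgaussianMGF.sum_of_iIndepFun hind (c := fun _ => K) hj).const_mul (1 / T)
  refine (hmul.congr (ae_of_all _ fun D => ?_)).mono (le_of_eq ?_)
  · simp only [trueLoss, empLoss, Finset.sum_sub_distrib, Finset.sum_const, Finset.card_univ,
      Fintype.card_fin, nsmul_eq_mul]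
    field_simp
    ring
  · rw [← NNReal.coe_inj]
    change (1 / (T : ℝ)) ^ 2 * ((∑ _j : Fin T, K : ℝ≥0) : ℝ) = ((K / T : ℝ≥0) : ℝ)
    simp only [Finset.sum_const, Finset.card_univ, Fintype.card_fin, nsmul_eq_mul]
    push_cast
    field_simp

end
end PacBayesRL

/-! ### The PAC-Bayes bound -/

open PacBayesRL in
theorem theorem1
    {S A Θ Ω : Type*} [MeasurableSpace S] [MeasurableSpace A] [MeasurableSpace Θ]
    [MeasurableSpace Ω] {Rmax : ℝ}
    (M : MDP S A Rmax) (π : Θ → Policy S A) (H : ℕ∞) (T : ℕ) (hT : 0 < T)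
    (hτ : (⨆ θ, tauMin M (π θ) H) < ∞)
    (P : Measure Ω) [IsProbabilityMeasure P]
    (D : Θ → Ω → Fin T → Traj S A Rmax H)
    (hD_meas : Measurable (fun q : Θ × Ω => D q.1 q.2))
    (hD_law : ∀ θ, P.map (D θ) = sampleLaw M (π θ) H T)
    (μ : Measure Θ) [IsProbabilityMeasure μ] (δ : ℝ) (hδ0 : 0 < δ) (hδ1 : δ < 1) :
    ∃ E : Set Ω, MeasurableSet E ∧ ENNReal.ofReal (1 - δ) ≤ P E ∧
      ∀ ω ∈ E, ∀ ρ : Measure Θ, IsProbabilityMeasure ρ → InformationTheory.klDiv ρ μ ≠ ∞ →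
        Integrable (fun θ => trueLoss M (π θ) H) ρ ∧
        Integrable (fun θ => empLoss M.γ (D θ ω)) ρ ∧
        (∫ θ, (trueLoss M (π θ) H - empLoss M.γ (D θ ω)) ∂ρ ≤
          Real.sqrt (Rmax ^ 2 * (⨆ θ, tauMin M (π θ) H).toReal * (1 - powTwoHorizon M.γ H) /
              (2 * (T : ℝ) * (1 - M.γ ^ 2)) *
            ((InformationTheory.klDiv ρ μ).toReal + Real.log (2 / δ)))) ∧
        ((∫ θ, - empLoss M.γ (D θ ω) ∂ρ) -
            Real.sqrt (Rmax ^ 2 * (⨆ θ, tauMin M (π θ) H).toReal * (1 - powTwoHorizon M.γ H) /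
                (2 * (T : ℝ) * (1 - M.γ ^ 2)) *
              ((InformationTheory.klDiv ρ μ).toReal + Real.log (2 / δ))) ≤
          ∫ θ, value M (π θ) H ∂ρ) := by

  set τ := ⨆ θ, tauMin M (π θ) H with hτ_def
  obtain ⟨θ₀⟩ := nonempty_of_isProbabilityMeasure μ
  have hR : 0 ≤ Rmax := Rmax_nonneg M (π θ₀)
  have hret : Measurable (ret M.γ : Traj S A Rmax H → ℝ) := measurable_ret H M.γ
  have hDθ : ∀ θ, Measurable (D θ) := fun θ => hD_meas.comp measurable_prodMk_left
  have hD_eval : ∀ j, Measurable fun q : Θ × Ω => D q.1 q.2 j := fun j =>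
    (measurable_pi_apply j).comp hD_meas
  set B := Rmax / (1 - M.γ) with hB
  have hret_mem : ∀ ξ : Traj S A Rmax H, ret M.γ ξ ∈ Set.Icc 0 B := ret_mem_Icc M hR H
  -- The policies are not assumed to depend measurably on `θ`; their values do so nevertheless,
  -- being integrals of the jointly measurable samples.
  have hvalue : ∀ θ, value M (π θ) H = ∫ ω, ret M.γ (D θ ω ⟨0, hT⟩) ∂P := fun θ => by
    rw [value, ← map_eval_sampleLaw M (π θ) H ⟨0, hT⟩, ← hD_law θ,
      Measure.map_map (measurable_pi_apply _) (hDθ θ),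
      integral_map ((measurable_pi_apply _).comp (hDθ θ)).aemeasurable hret.aestronglyMeasurable]
    rfl
  have hvalue_meas : Measurable fun θ => value M (π θ) H := by
    simp_rw [hvalue]
    exact (StronglyMeasurable.integral_prod_right' (ν := P)
      (f := fun q : Θ × Ω => ret M.γ (D q.1 q.2 ⟨0, hT⟩))
      (hret.comp (hD_eval _)).stronglyMeasurable).measurable
  have hvalue_mem : ∀ θ, value M (π θ) H ∈ Set.Icc 0 B := fun θ => by
    rw [hvalue]
    refine ⟨integral_nonneg fun ω => (hret_mem _).1, ?_⟩
    calc ∫ ω, ret M.γ (D θ ω ⟨0, hT⟩) ∂P ≤ ∫ _, B ∂P :=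
          integral_mono_of_nonneg (ae_of_all _ fun ω => (hret_mem _).1) (integrable_const _)
            (ae_of_all _ fun ω => (hret_mem _).2)
      _ = B := by simp
  have hloss_meas : Measurable fun θ => trueLoss M (π θ) H := hvalue_meas.neg
  have hloss_mem : ∀ θ, trueLoss M (π θ) H ∈ Set.Icc (-B) 0 := fun θ =>
    ⟨neg_le_neg (hvalue_mem θ).2, neg_nonpos.2 (hvalue_mem θ).1⟩
  have hemp_meas : Measurable fun q : Θ × Ω => empLoss M.γ (D q.1 q.2) :=
    ((Finset.measurable_fun_sum _ fun j _ => hret.comp (hD_eval j)).const_mul _).neg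
  have hemp_mem : ∀ ξ : Fin T → Traj S A Rmax H, empLoss M.γ ξ ∈ Set.Icc (-B) 0 := fun ξ => by
    have hT' : (0 : ℝ) < T := by exact_mod_cast hT
    refine ⟨neg_le_neg ?_, neg_nonpos.2 (mul_nonneg (by positivity)
      (Finset.sum_nonneg fun j _ => (hret_mem _).1))⟩
    rw [one_div, inv_mul_le_iff₀ hT']
    calc ∑ j, ret M.γ (ξ j) ≤ ∑ _j : Fin T, B := Finset.sum_le_sum fun j _ => (hret_mem _).2
      _ = T * B := by simp
  have hC0 : 0 ≤ (1 - powTwoHorizon M.γ H) / (1 - M.γ ^ 2) := by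
    simpa using sum_discountWeight_sq_le M H 0
  set K : NNReal := NNReal.mk (τ.toReal *
    (Rmax ^ 2 * ((1 - powTwoHorizon M.γ H) / (1 - M.γ ^ 2)) / 8)) (by positivity) with hK
  have hsub : ∀ θ, HasSubgaussianMGF
      (fun ω => trueLoss M (π θ) H - empLoss M.γ (D θ ω)) (K / T) P := fun θ => by
    refine HasSubgaussianMGF.of_map (Y := D θ)
      (X := fun ξ => trueLoss M (π θ) H - empLoss M.γ ξ) (hDθ θ).aemeasurable ?_
    rw [hD_law θ]
    refine hasSubgaussianMGF_trueLoss_sub_empLoss hT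
      (hasSubgaussianMGF_ret (τ := τ.toNNReal) ?_ rfl)
    rw [ENNReal.coe_toNNReal hτ.ne]
    exact le_iSup (fun θ => tauMin M (π θ) H) θ
  obtain ⟨E, hE, hPE, hbound⟩ := exists_forall_integral_le_sqrt_klDiv (P := P)
    (X := fun θ ω => trueLoss M (π θ) H - empLoss M.γ (D θ ω))
    ((hloss_meas.comp measurable_fst).sub hemp_meas) (B := B)
    (fun θ ω => abs_le.2 ⟨by linarith [(hloss_mem θ).1, (hemp_mem (D θ ω)).2],
      by linarith [(hloss_mem θ).2, (hemp_mem (D θ ω)).1]⟩) hsub μ hδ0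
  refine ⟨E, hE, hPE, fun ω hω ρ hρ hkl => ?_⟩
  have hi1 : Integrable (fun θ => trueLoss M (π θ) H) ρ :=
    Integrable.of_mem_Icc _ _ hloss_meas.aemeasurable (ae_of_all _ hloss_mem)
  have hi2 : Integrable (fun θ => empLoss M.γ (D θ ω)) ρ :=
    Integrable.of_mem_Icc _ _ (hemp_meas.comp measurable_prodMk_right).aemeasurable
      (ae_of_all _ fun θ => hemp_mem (D θ ω))
  have hmain := hbound ω hω ρ hρ hkl
  have hconst : 4 * ((K / T : NNReal) : ℝ) =
      Rmax ^ 2 * τ.toReal * (1 - powTwoHorizon M.γ H) / (2 * (T : ℝ) * (1 - M.γ ^ 2)) := by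
    have h1 : 1 - M.γ ^ 2 ≠ 0 := by nlinarith [M.γ_pos, M.γ_lt_one]
    have h2 : (T : ℝ) ≠ 0 := by positivity
    rw [NNReal.coe_div, NNReal.coe_natCast, hK, NNReal.coe_mk]
    field_simp
    ring
  rw [hconst] at hmain
  refine ⟨hi1, hi2, hmain, ?_⟩
  rw [integral_sub hi1 hi2] at hmain
  have h3 : ∫ θ, trueLoss M (π θ) H ∂ρ = -∫ θ, value M (π θ) H ∂ρ := integral_neg _
  rw [integral_neg]
  linarith
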